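/- Let $k$ be an algebraically closed field of characteristic $0$, let $X$ be a K3 surface over $k$ (a smooth proper geometrically integral surface with $\omega_X\cong\mathcal O_X$ and $H^1(X,\mathcal O_X)=0$), and let $\pi\colon X\to\mathbb P^1_k$ be a genus $1$ fibration, i.e. a $k$-morphism whose generic fibre $X_{k(u)}:=X\times_{\mathbb P^1_k}\operatorname{Spec}k(u)$ is a smooth, proper, geometrically integral curve of genus $1$ over $k(u)$, where $u$ is the affine coordinate of $\mathbb P^1_k$. A curve over a field is a reduced separated scheme of finite type and of dimension $1$; a curve $C$ over an extension field $L$ of $k$ is called constant over $k$ if there is a curve $C_0$ over $k$ with $C\cong C_0\otimes_k L$ over $L$. Then for every rational extension $k(t)/k(u)$, i.e. every $k$-embedding $k(u)\hookrightarrow k(t)$ into a rational function field in one variable, the base change $X_{k(t)}:=X_{k(u)}\otimes_{k(u)}k(t)$ is a curve over $k(t)$ that is not constant over $k$. -/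

import Mathlib

open CategoryTheory AlgebraicGeometry TopologicalSpace Limits
open scoped KaehlerDifferential

universe u

noncomputable section

namespace K3Fib

/-! ### Sections of the structure sheaf as algebras over the ground field -/

/-- The ring `Γ(X, U)`, regarded as an algebra over `K` through `f : X ⟶ Spec K`. -/
def Sec {K : Type u} [Field K] {X : Scheme.{u}} (_f : X ⟶ Spec (.of K)) (U : X.Opens) : Type u :=
  Γ(X, U)

section Sec

variable {K : Type u} [Field K] {X : Scheme.{u}} (f : X ⟶ Spec (.of K))

instance (U : X.Opens) : CommRing (Sec f U) := inferInstanceAs (CommRing Γ(X, U))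

/-- The ring homomorphism `K → Γ(X, U)` induced by `f : X ⟶ Spec K`. -/
def scalar (U : X.Opens) : K →+* Sec f U :=
  ((Scheme.ΓSpecIso (.of K)).inv ≫ f.appTop ≫ X.presheaf.map (homOfLE le_top : U ⟶ ⊤).op).hom

instance (U : X.Opens) : Algebra K (Sec f U) := (scalar f U).toAlgebra

/-- Restriction of functions to a smaller open set, as a homomorphism of `K`-algebras. -/
def res {U V : X.Opens} (h : V ≤ U) : Sec f U →ₐ[K] Sec f V where
  __ := (X.presheaf.map (homOfLE h).op).hom
  commutes' r := by
    have e : X.presheaf.map (homOfLE le_top : U ⟶ ⊤).op ≫ X.presheaf.map (homOfLE h).op =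
        X.presheaf.map (homOfLE le_top : V ⟶ ⊤).op := (X.presheaf.map_comp _ _).symm
    exact ConcreteCategory.congr_hom e
      (((Scheme.ΓSpecIso (.of K)).inv ≫ f.appTop).hom r)

/-! ### Cohomology of the structure sheaf -/

/-- The structure sheaf `𝒪_X` as a presheaf of `K`-modules. -/
def structurePresheaf : (Opens X)ᵒᵖ ⥤ ModuleCat.{u} K where
  obj U := ModuleCat.of K (Sec f U.unop)
  map i := ModuleCat.ofHom (res f i.unop.le).toLinearMap
  map_id U := by
    ext x
    exact ConcreteCategory.congr_hom (X.presheaf.map_id U) x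
  map_comp i j := by
    ext x
    exact ConcreteCategory.congr_hom (X.presheaf.map_comp i j) x

/-- The structure sheaf `𝒪_X` as a sheaf of `K`-modules on the Zariski site of `X`. -/
def structureSheaf : Sheaf (Opens.grothendieckTopology X) (ModuleCat.{u} K) :=
  ⟨structurePresheaf f, by
    rw [Presheaf.isSheaf_iff_isSheaf_forget _ _ (forget (ModuleCat.{u} K))]
    exact (Presheaf.isSheaf_iff_isSheaf_forget _ _ (forget CommRingCat.{u})).mp X.sheaf.2⟩

/-- Sheaf cohomology `Hⁿ(X, 𝒪_X)`: the derived functor of global sections, that is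
`Extⁿ(K_X, 𝒪_X)` in the category of sheaves of `K`-modules, `K_X` being the constant sheaf. -/
abbrev cohomology (n : ℕ) : Type u :=
  Abelian.Ext ((constantSheaf (Opens.grothendieckTopology X) (ModuleCat.{u} K)).obj
    (ModuleCat.of K K)) (structureSheaf f) n

end Sec

/-! ### Differential forms -/

/-- The map `⋀ᵖ Ω_{A/K} → ⋀ᵖ Ω_{B/K}` induced by a homomorphism `A → B` of `K`-algebras:
`a₀ da₁ ∧ ⋯ ∧ daₚ ↦ g(a₀) dg(a₁) ∧ ⋯ ∧ dg(aₚ)`. -/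
def formMap {K A B : Type u} [Field K] [CommRing A] [CommRing B] [Algebra K A] [Algebra K B]
    (g : A →ₐ[K] B) (p : ℕ) : (⋀[A]^p Ω[A⁄K]) →+ (⋀[B]^p Ω[B⁄K]) :=
  letI : Algebra A B := g.toRingHom.toAlgebra
  haveI : IsScalarTower K A B := IsScalarTower.of_algebraMap_eq fun r => (g.commutes r).symm
  (exteriorPower.alternatingMapLinearEquiv (R := A)
    (N := (⋀[B]^p Ω[B⁄K]))
    { toMultilinearMap :=
        ((exteriorPower.ιMulti B p (M := Ω[B⁄K])).toMultilinearMap.restrictScalars A).compLinearMap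
          fun _ => KaehlerDifferential.map K K A B
      map_eq_zero_of_eq' := fun _ _ _ h hij =>
        (exteriorPower.ιMulti B p (M := Ω[B⁄K])).map_eq_zero_of_eq _
          (congrArg (KaehlerDifferential.map K K A B) h) hij }).toAddMonoidHom

/-- The canonical bundle `⋀² Ω_{X/K}` of a smooth surface `X` over `K` is trivial: there is a global
`2`-form, given by a compatible family of sections over the affine open subsets of `X`, such that
multiplication by it is an isomorphism from `𝒪_X` to `⋀² Ω_{X/K}`. -/
def TrivialCanonicalBundle {K : Type u} [Field K] {X : Scheme.{u}} (f : X ⟶ Spec (.of K)) : Prop :=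
  ∃ ω : ∀ U : X.affineOpens, ⋀[Sec f U.1]^2 Ω[Sec f U.1⁄K],
    (∀ (U V : X.affineOpens) (h : V.1 ≤ U.1), formMap (res f h) 2 (ω U) = ω V) ∧
    ∀ U : X.affineOpens, Function.Bijective fun a : Sec f U.1 => a • ω U

/-! ### Curves and K3 surfaces -/

/-- A K3 surface over a field `k`: a smooth proper geometrically integral surface `X` with trivial
canonical bundle and `H¹(X, 𝒪_X) = 0`. -/
structure IsK3Surface {k : Type u} [Field k] {X : Scheme.{u}} (f : X ⟶ Spec (.of k)) : Prop where
  smooth : SmoothOfRelativeDimension 2 f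
  proper : IsProper f
  geometricallyIntegral : GeometricallyIntegral f
  trivialCanonicalBundle : TrivialCanonicalBundle f
  irregularity : Subsingleton (cohomology f 1)

/-- A curve over a field `K`: a reduced separated scheme of finite type over `K`, of dimension `1`. -/
structure IsCurve {K : Type u} [Field K] {C : Scheme.{u}} (c : C ⟶ Spec (.of K)) : Prop where
  reduced : IsReduced C
  separated : IsSeparated c
  locallyOfFiniteType : LocallyOfFiniteType c
  quasiCompact : QuasiCompact c
  dim_eq_one : topologicalKrullDim C = 1

/-- A smooth, proper, geometrically integral curve of genus `1` over a field `K`, the genus being the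
dimension of `H¹(C, 𝒪_C)`. -/
structure IsGenusOneCurve {K : Type u} [Field K] {C : Scheme.{u}} (c : C ⟶ Spec (.of K)) :
    Prop where
  isCurve : IsCurve c
  smooth : Smooth c
  proper : IsProper c
  geometricallyIntegral : GeometricallyIntegral c
  genus_eq_one : Module.finrank K (cohomology c 1) = 1

/-- A curve `C` over an extension `L` of `k` is constant over `k` if it is isomorphic over `L` to the
base change `C₀ ⊗_k L` of a curve `C₀` over `k`. -/
def IsConstant (k : Type u) {L : Type u} [Field k] [Field L] [Algebra k L] {C : Scheme.{u}}
    (c : C ⟶ Spec (.of L)) : Prop :=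
  ∃ (C₀ : Scheme.{u}) (c₀ : C₀ ⟶ Spec (.of k)), IsCurve c₀ ∧
    Nonempty (Over.mk c ≅
      Over.mk (pullback.snd c₀ (Spec.map (CommRingCat.ofHom (algebraMap k L)))))

/-! ### The projective line and its generic point -/

section ProjectiveLine

variable (k : Type u) [Field k]

instance : GradedAlgebra (MvPolynomial.homogeneousSubmodule (Fin 2) k) :=
  MvPolynomial.gradedAlgebra

/-- The projective line `Proj k[x₀, x₁]`. -/
abbrev P1 : Scheme.{u} := Proj (MvPolynomial.homogeneousSubmodule (Fin 2) k)

/-- The structure morphism of the projective line. -/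
def P1.toSpec : P1 k ⟶ Spec (.of k) :=
  Proj.toSpecZero (MvPolynomial.homogeneousSubmodule (Fin 2) k) ≫
    Spec.map (CommRingCat.ofHom
      (algebraMap k (MvPolynomial.homogeneousSubmodule (Fin 2) k 0)))

/-- The homomorphism from the coordinate ring of the chart `x₀ ≠ 0` of the projective line to the
field `k(u)` of rational functions, which sends the affine coordinate `x₁ / x₀` to `u`. -/
def P1.chartToRatFunc :
    HomogeneousLocalization.Away (MvPolynomial.homogeneousSubmodule (Fin 2) k)
      (MvPolynomial.X 0) →+* RatFunc k :=
  (IsLocalization.Away.lift (S := Localization.Away (MvPolynomial.X 0 : MvPolynomial (Fin 2) k))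
    (MvPolynomial.X 0)
    (g := (MvPolynomial.aeval (R := k) ![(1 : RatFunc k), RatFunc.X]).toRingHom)
    (by simp)).comp (algebraMap _ _)

/-- The inclusion `Spec k(u) ⟶ ℙ¹` of the generic point, `u = x₁ / x₀` being the affine
coordinate. -/
def P1.genericPoint : Spec (.of (RatFunc k)) ⟶ P1 k :=
  Spec.map (CommRingCat.ofHom (P1.chartToRatFunc k)) ≫
    Proj.awayι (MvPolynomial.homogeneousSubmodule (Fin 2) k) (MvPolynomial.X 0)
      ((MvPolynomial.mem_homogeneousSubmodule 1 _).mpr (MvPolynomial.isHomogeneous_X k 0)) one_pos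

end ProjectiveLine

/-! ### Genus one fibrations -/

section Fibration

variable {k : Type u} [Field k] {X : Scheme.{u}}

/-- The generic fibre `X_{k(u)}` of `π : X ⟶ ℙ¹`. -/
abbrev genericFibre (π : X ⟶ P1 k) : Scheme.{u} := pullback π (P1.genericPoint k)

/-- The structure morphism of the generic fibre `X_{k(u)}` of `π : X ⟶ ℙ¹`. -/
abbrev genericFibreToSpec (π : X ⟶ P1 k) : genericFibre π ⟶ Spec (.of (RatFunc k)) :=
  pullback.snd π (P1.genericPoint k)

/-- The morphism `π : X ⟶ ℙ¹` of `k`-schemes is a genus `1` fibration: its generic fibre is a smooth,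
proper, geometrically integral curve of genus `1` over `k(u)`. -/
structure IsGenusOneFibration (f : X ⟶ Spec (.of k)) (π : X ⟶ P1 k) : Prop where
  comp_toSpec : π ≫ P1.toSpec k = f
  generic : IsGenusOneCurve (genericFibreToSpec π)

/-- The structure morphism `X_{k(t)} ⟶ Spec k(t)` of the base change of the generic fibre of `π`
along an embedding `φ : k(u) → k(t)` over `k`. -/
abbrev genericFibreBaseChangeToSpec (π : X ⟶ P1 k) (φ : RatFunc k →ₐ[k] RatFunc k) :
    pullback (genericFibreToSpec π) (Spec.map (CommRingCat.ofHom φ.toRingHom)) ⟶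
      Spec (.of (RatFunc k)) :=
  pullback.snd (genericFibreToSpec π) (Spec.map (CommRingCat.ofHom φ.toRingHom))

end Fibration

end K3Fib

end

/-! Suppose `X_{k(t)} ≅ C ⊗ k(t)` and let `F` be the function field of `C`. The generic point of `C
⊗ k(t)` gives a point `x : Spec F(t) ⟶ X`, so `X` would be dominated by the ruled surface `C × ℙ¹`,
although it carries a nowhere vanishing 2-form `ω`. The argument stays at the level of the field
`F(t)`, with no model of `C × ℙ¹`.

By the valuative criterion, `ω` pulled back along `x` takes values in a valuation ring of `F(t)`
over `k` on any two derivations preserving that ring (`evalForm_mem_valuationSubring`). Take `∂/∂t`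
and a derivation `d` of `F` extended coefficientwise. The value has no finite pole, and `t` times it
has none at infinity, because `t ∂/∂t` is regular there; so it vanishes
(`evalForm_ratFunc_eq_zero`).

Dominance of `x` becomes: a derivation `D` of `F(t)` killing the functions at `x` is zero. Its
constants contain `u`, hence `k(t)`, which is algebraic over `k(u)`. So the point of `X_{k(t)}` is
defined over the constants (`exists_point_constants`), and by the isomorphism so is the generic
point of `C`; the constants therefore contain `F` and `t`. As `ω` generates the 2-forms, both facts
together force `d = 0` (`derivation_eq_zero_of_dominant`). But `F` is transcendental over `k`, so a
nonzero `d` exists (`exists_derivation_ne_zero`).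

That `X_{k(t)}` is a curve holds because `k(t)/k(u)` is finite and finite surjective maps preserve
dimension. -/

noncomputable section

namespace K3Fib

/-! ### Derivations of fields -/

section Derivations

open scoped IntermediateField.algebraAdjoinAdjoin

/-- A derivation of `A` with values in a formally étale `A`-algebra `B` extends to `B`. -/
lemma exists_derivation_formallyEtale {R A B : Type*} [CommRing R] [CommRing A] [CommRing B]
    [Algebra R A] [Algebra R B] [Algebra A B] [IsScalarTower R A B] [Algebra.FormallyEtale A B]
    (d : Derivation R A B) : ∃ D : Derivation R B B, ∀ a, D (algebraMap A B a) = d a := by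
  -- Étaleness gives `Ω[B⁄R] = B ⊗ Ω[A⁄R]`, so the linear map attached to `d` extends.
  have h := KaehlerDifferential.isBaseChange_of_formallyEtale R A B
  refine ⟨(h.lift d.liftKaehlerDifferential).compDer (KaehlerDifferential.D R B), fun a => ?_⟩
  simpa using h.lift_eq d.liftKaehlerDifferential (KaehlerDifferential.D R A a)

/-- A derivation of `A` extends to every localization of `A`. -/
lemma exists_derivation_localization {R A B : Type*} [CommRing R] [CommRing A] [CommRing B]
    [Algebra R A] [Algebra R B] [Algebra A B] [IsScalarTower R A B] (M : Submonoid A)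
    [IsLocalization M B] (d : Derivation R A A) :
    ∃ D : Derivation R B B, ∀ a, D (algebraMap A B a) = algebraMap A B (d a) := by
  have := Algebra.FormallyEtale.of_isLocalization (Rₘ := B) M
  exact exists_derivation_formallyEtale ((Algebra.linearMap A B).compDer d)

/-- The coefficientwise extension of a derivation of `F` to `F[X]`. -/
lemma exists_derivation_coeff {k F : Type*} [CommRing k] [CommRing F] [Algebra k F]
    (d : Derivation k F F) :
    ∃ D : Derivation k (Polynomial F) (Polynomial F), ∀ p n, (D p).coeff n = d (p.coeff n) :=
  ⟨PolynomialModule.equivPolynomialSelf.compDer d.mapCoeffs, fun _ _ => rfl⟩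

/-- A derivation that annihilates a field annihilates all elements algebraic over it, in
characteristic zero. -/
lemma derivation_eq_zero_of_isAlgebraic {k E L M : Type*} [CommRing k] [Field E] [CharZero E]
    [Field L] [Algebra k L] [Algebra E L] [AddCommGroup M] [Module k M] [Module L M]
    (D : Derivation k L M)
    (hD : ∀ e : E, D (algebraMap E L e) = 0) {x : L} (hx : IsAlgebraic E x) : D x = 0 := by
  let : Module E M := Module.compHom M (algebraMap E L)
  have : IsScalarTower E L M := ⟨fun e y m => by rw [Algebra.smul_def, mul_smul]; rfl⟩
  let D' : Derivation E L M :=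
    { toFun := D
      map_add' := map_add D
      map_smul' := fun e y => by
        rw [Algebra.smul_def, D.leibniz, hD, smul_zero, add_zero]; rfl
      map_one_eq_zero' := D.map_one_eq_zero
      leibniz' := D.leibniz }
  -- With `p` the minimal polynomial, `0 = D' (p x) = p'(x) • D' x`, and `p'(x) ≠ 0` by
  -- separability.
  have hsep := (minpoly.irreducible hx.isIntegral).separable
  have h := D'.map_aeval (minpoly E x) x
  rw [minpoly.aeval, map_zero] at h
  rcases smul_eq_zero.mp h.symm with h | h
  · exact absurd h (hsep.aeval_derivative_ne_zero (minpoly.aeval E x))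
  · exact h

/-- The field of constants of a derivation. -/
def constants {k L M : Type*} [Field k] [Field L] [Algebra k L] [AddCommGroup M] [Module k M]
    [Module L M] (D : Derivation k L M) : IntermediateField k L where
  carrier := {x | D x = 0}
  mul_mem' {a b} ha hb := by
    rw [Set.mem_ofPred_eq] at *
    rw [D.leibniz, ha, hb, smul_zero, smul_zero, add_zero]
  add_mem' {a b} ha hb := by
    rw [Set.mem_ofPred_eq] at *
    rw [map_add, ha, hb, add_zero]
  algebraMap_mem' r := D.map_algebraMap r
  inv_mem' a ha := by
    rw [Set.mem_ofPred_eq] at *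
    rw [D.leibniz_inv, ha, smul_zero]

lemma mem_constants {k L M : Type*} [Field k] [Field L] [Algebra k L] [AddCommGroup M] [Module k M]
    [Module L M] {D : Derivation k L M} {x : L} : x ∈ constants D ↔ D x = 0 := Iff.rfl

/-- A derivation of a rational function field that annihilates a nonconstant function vanishes, in
characteristic zero. -/
lemma ratFunc_derivation_eq_zero {k M : Type*} [Field k] [CharZero k] [AddCommGroup M] [Module k M]
    [Module (RatFunc k) M] (D : Derivation k (RatFunc k) M) {y : RatFunc k}
    (hy : Transcendental k y) (h : D y = 0) (z : RatFunc k) : D z = 0 := by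
  have hX : RatFunc.X ∈ constants D := by
    refine derivation_eq_zero_of_isAlgebraic (E := constants D) D (fun e => e.2)
      (RatFunc.IntermediateField.isAlgebraic_X fun hbot => hy ?_)
    obtain ⟨c, rfl⟩ := IntermediateField.mem_bot.mp (hbot ▸ mem_constants.mpr h)
    exact isAlgebraic_algebraMap c
  have htop : (⊤ : IntermediateField k (RatFunc k)) ≤ constants D := by
    rw [← RatFunc.adjoin_X, IntermediateField.adjoin_simple_le_iff]
    exact hX
  exact htop IntermediateField.mem_top

/-- A transcendental extension in characteristic zero has a nonzero derivation. -/
lemma exists_derivation_ne_zero {k F : Type*} [Field k] [CharZero k] [Field F] [Algebra k F]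
    (h : ¬ Algebra.IsAlgebraic k F) : ∃ d : Derivation k F F, d ≠ 0 := by
  obtain ⟨s, hs⟩ := exists_isTranscendenceBasis k F
  obtain ⟨i⟩ : Nonempty s := not_isEmpty_iff.mp fun h' => h (hs.isEmpty_iff_isAlgebraic.mp h')
  let v : s → F := (↑)
  let A := Algebra.adjoin k (Set.range v)
  let E := IntermediateField.adjoin k (Set.range v)
  have : Algebra.IsAlgebraic E F := hs.isAlgebraic_field
  have : Algebra.FormallyEtale E F := Algebra.FormallyEtale.of_isSeparable E F
  have : Algebra.FormallyEtale A E := Algebra.FormallyEtale.of_isLocalization (nonZeroDivisors A)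
  have : Algebra.FormallyEtale A F := Algebra.FormallyEtale.comp A E F
  let e : MvPolynomial s k ≃ₐ[k] A := hs.1.aevalEquiv
  have he (a : A) : MvPolynomial.aeval v (e.symm a) = a := by
    rw [← hs.1.algebraMap_aevalEquiv]
    exact congrArg Subtype.val (e.apply_symm_apply a)
  -- The partial derivative along one element `i` of a transcendence basis; it takes the value 1 at
  -- `i`, so its extension is nonzero.
  let d : Derivation k A F :=
    Derivation.mk' ((MvPolynomial.aeval v).toLinearMap ∘ₗ (MvPolynomial.pderiv i).toLinearMap ∘ₗ
      e.symm.toLinearMap) fun a b => by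
        simp [Derivation.leibniz, he, Algebra.smul_def]
  obtain ⟨D, hD⟩ := exists_derivation_formallyEtale d
  refine ⟨D, fun h0 => ?_⟩
  have h1 := hD (e (MvPolynomial.X i))
  simp [d, h0] at h1

/-- If `v (D p) ≤ v p` holds for the elements of `A`, then also for those of its fraction field. -/
lemma valuation_derivation_le {R A L Γ₀ : Type*} [CommRing R] [CommRing A] [IsDomain A] [Field L]
    [Algebra R L] [Algebra A L] [IsFractionRing A L] [LinearOrderedCommGroupWithZero Γ₀]
    (v : Valuation L Γ₀) (D : Derivation R L L)
    (h : ∀ a : A, v (D (algebraMap A L a)) ≤ v (algebraMap A L a)) (x : L) : v (D x) ≤ v x := by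
  obtain ⟨n, d, hd, rfl⟩ := IsFractionRing.div_surjective (A := A) x
  have hd0 : algebraMap A L d ≠ 0 := IsFractionRing.to_map_ne_zero_of_mem_nonZeroDivisors hd
  set x := algebraMap A L n / algebraMap A L d with hx
  have e : x * algebraMap A L d = algebraMap A L n := div_mul_cancel₀ _ hd0
  -- The quotient rule with one denominator cleared; both terms on the right have valuation at most
  -- that of `n`.
  have e' : D x * algebraMap A L d = D (algebraMap A L n) - x * D (algebraMap A L d) := by
    rw [← e, D.leibniz]; simp only [smul_eq_mul]; ring
  have hv : 0 < v (algebraMap A L d) := zero_lt_iff.mpr ((map_ne_zero v).mpr hd0)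
  rw [← mul_le_mul_iff_left₀ hv, ← map_mul, ← map_mul, e', e]
  refine (v.map_sub _ _).trans (max_le (h n) ?_)
  rw [← e, map_mul, map_mul]
  gcongr
  exact h d

/-- A derivation of the fraction field that preserves a Dedekind domain preserves the local rings at
its primes. -/
lemma valuation_derivation_le_one {R A L : Type*} [CommRing R] [CommRing A] [IsDedekindDomain A]
    [Field L] [Algebra R L] [Algebra A L] [IsFractionRing A L]
    (v : IsDedekindDomain.HeightOneSpectrum A) (D : Derivation R L L)
    (h : ∀ a : A, ∃ b : A, D (algebraMap A L a) = algebraMap A L b) {x : L}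
    (hx : v.valuation L x ≤ 1) : v.valuation L (D x) ≤ 1 := by
  obtain ⟨n, d, e⟩ := v.exists_primeCompl_mul_eq_of_integer x hx
  have hD (a : A) : v.valuation L (D (algebraMap A L a)) ≤ 1 := by
    obtain ⟨b, hb⟩ := h a
    rw [hb]
    exact v.valuation_le_one b
  have e' : D x * algebraMap A L d = D (algebraMap A L n) - x * D (algebraMap A L d) := by
    rw [← e, D.leibniz]; simp only [smul_eq_mul]; ring
  have hd : v.valuation L (algebraMap A L d) = 1 := by
    rw [v.valuation_of_algebraMap]
    exact (v.intValuation_eq_one_iff_mem_primeCompl _).mpr d.2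
  rw [← mul_one (v.valuation L (D x)), ← hd, ← map_mul, e', hd]
  refine ((v.valuation L).map_sub _ _).trans (max_le (hD n) ?_)
  rw [map_mul]
  exact mul_le_one' hx (hD d)

/-- A rational function `g` without poles at finite distance, for which `X * g` has no pole at
infinity, vanishes. -/
lemma ratFunc_eq_zero_of_valuation {F : Type*} [Field F] [DecidableEq (RatFunc F)] {g : RatFunc F}
    (hfin : ∀ v : IsDedekindDomain.HeightOneSpectrum (Polynomial F), v.valuation (RatFunc F) g ≤ 1)
    (hinf : RatFunc.inftyValuation F (RatFunc.X * g) ≤ 1) : g = 0 := by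
  obtain ⟨p, rfl⟩ := IsDedekindDomain.HeightOneSpectrum.mem_integers_of_valuation_le_one _ g hfin
  by_contra hp
  have hp0 : p ≠ 0 := fun h => hp (by simp [h])
  -- The valuation at infinity is `exp` of the degree, and `1 + deg p ≤ 0` is impossible.
  rw [map_mul, RatFunc.inftyValuation.X, RatFunc.inftyValuation_apply,
    RatFunc.inftyValuation.polynomial _ hp0,
    ← WithZero.exp_add, ← WithZero.exp_zero, WithZero.exp_le_exp] at hinf
  omega

end Derivations

/-! ### Pulling back differential forms -/

section Forms

variable {K A B C : Type u} [Field K] [CommRing A] [CommRing B] [CommRing C]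
  [Algebra K A] [Algebra K B] [Algebra K C]

/-- The map `Ω_{A/K} → Ω_{B/K}` induced by a homomorphism of `K`-algebras. -/
def kaehlerMap (g : A →ₐ[K] B) : Ω[A⁄K] →+ Ω[B⁄K] :=
  letI : Algebra A B := g.toRingHom.toAlgebra
  haveI : IsScalarTower K A B := IsScalarTower.of_algebraMap_eq fun r => (g.commutes r).symm
  (KaehlerDifferential.map K K A B).toAddMonoidHom

lemma kaehlerMap_D (g : A →ₐ[K] B) (a : A) :
    kaehlerMap g (KaehlerDifferential.D K A a) = KaehlerDifferential.D K B (g a) :=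
  let : Algebra A B := g.toRingHom.toAlgebra
  have : IsScalarTower K A B := IsScalarTower.of_algebraMap_eq fun r => (g.commutes r).symm
  KaehlerDifferential.map_D K K A B a

/-- The `A`-module structure on forms over `B` is only a local instance, so linearity is stated as
semilinearity along `g`. -/
lemma kaehlerMap_smul (g : A →ₐ[K] B) (a : A) (x : Ω[A⁄K]) :
    kaehlerMap g (a • x) = g a • kaehlerMap g x := by
  let : Algebra A B := g.toRingHom.toAlgebra
  have : IsScalarTower K A B := IsScalarTower.of_algebraMap_eq fun r => (g.commutes r).symm
  exact ((KaehlerDifferential.map K K A B).map_smul a x).trans (algebraMap_smul B a _).symm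

/-- Induction on differential forms of degree one. -/
lemma kaehler_induction {P : Ω[A⁄K] → Prop} (hD : ∀ a, P (KaehlerDifferential.D K A a))
    (hadd : ∀ x y, P x → P y → P (x + y)) (hsmul : ∀ (a : A) x, P x → P (a • x)) (x : Ω[A⁄K]) :
    P x := by
  have hx : x ∈ Submodule.span A (Set.range (KaehlerDifferential.D K A)) :=
    (KaehlerDifferential.span_range_derivation K A).symm ▸ Submodule.mem_top
  induction hx using Submodule.span_induction with
  | mem x h => obtain ⟨a, rfl⟩ := h; exact hD a
  | zero => simpa using hD 0
  | add x y _ _ hx hy => exact hadd x y hx hy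
  | smul a x _ hx => exact hsmul a x hx

lemma kaehlerMap_comp (h : B →ₐ[K] C) (g : A →ₐ[K] B) (x : Ω[A⁄K]) :
    kaehlerMap (h.comp g) x = kaehlerMap h (kaehlerMap g x) := by
  induction x using kaehler_induction with
  | hD a => simp [kaehlerMap_D]
  | hadd x y hx hy => simp [hx, hy]
  | hsmul a x hx => simp [kaehlerMap_smul, hx]

lemma formMap_ιMulti (g : A →ₐ[K] B) (p : ℕ) (v : Fin p → Ω[A⁄K]) :
    formMap g p (exteriorPower.ιMulti A p v) =
      exteriorPower.ιMulti B p fun i => kaehlerMap g (v i) := by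
  let : Algebra A B := g.toRingHom.toAlgebra
  have : IsScalarTower K A B := IsScalarTower.of_algebraMap_eq fun r => (g.commutes r).symm
  exact exteriorPower.alternatingMapLinearEquiv_apply_ιMulti _ _

lemma formMap_smul (g : A →ₐ[K] B) (p : ℕ) (a : A) (x : ⋀[A]^p Ω[A⁄K]) :
    formMap g p (a • x) = g a • formMap g p x := by
  let : Algebra A B := g.toRingHom.toAlgebra
  have : IsScalarTower K A B := IsScalarTower.of_algebraMap_eq fun r => (g.commutes r).symm
  refine Eq.trans ?_ (algebraMap_smul B a (formMap g p x)).symm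
  exact (exteriorPower.alternatingMapLinearEquiv (R := A) (N := ⋀[B]^p Ω[B⁄K]) _).map_smul a x

/-- Induction on differential forms. -/
lemma form_induction {p : ℕ} {P : (⋀[A]^p Ω[A⁄K]) → Prop} (h0 : P 0)
    (hι : ∀ v, P (exteriorPower.ιMulti A p v))
    (hadd : ∀ x y, P x → P y → P (x + y)) (hsmul : ∀ (a : A) x, P x → P (a • x))
    (x : ⋀[A]^p Ω[A⁄K]) : P x := by
  have hx : x ∈ Submodule.span A (Set.range (exteriorPower.ιMulti A p (M := Ω[A⁄K]))) :=
    (exteriorPower.ιMulti_span A p Ω[A⁄K]).symm ▸ Submodule.mem_top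
  induction hx using Submodule.span_induction with
  | mem x h => obtain ⟨a, rfl⟩ := h; exact hι a
  | zero => exact h0
  | add x y _ _ hx hy => exact hadd x y hx hy
  | smul a x _ hx => exact hsmul a x hx

lemma formMap_comp (h : B →ₐ[K] C) (g : A →ₐ[K] B) (p : ℕ) (x : ⋀[A]^p Ω[A⁄K]) :
    formMap (h.comp g) p x = formMap h p (formMap g p x) := by
  induction x using form_induction with
  | h0 => simp
  | hι v => simp [formMap_ιMulti, kaehlerMap_comp]
  | hadd x y hx hy => simp [hx, hy]
  | hsmul a x hx => simp [formMap_smul, hx]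

/-- The evaluation of `2`-forms at a pair of derivations. -/
def evalForm (D₁ D₂ : Derivation K A A) : (⋀[A]^2 Ω[A⁄K]) →ₗ[A] A :=
  exteriorPower.alternatingMapLinearEquiv
    (Matrix.detRowAlternating.compLinearMap
      (LinearMap.pi ![D₁.liftKaehlerDifferential, D₂.liftKaehlerDifferential]))

lemma evalForm_ιMulti (D₁ D₂ : Derivation K A A) (v : Fin 2 → Ω[A⁄K]) :
    evalForm D₁ D₂ (exteriorPower.ιMulti A 2 v) =
      D₁.liftKaehlerDifferential (v 0) * D₂.liftKaehlerDifferential (v 1) -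
        D₂.liftKaehlerDifferential (v 0) * D₁.liftKaehlerDifferential (v 1) := by
  rw [evalForm, exteriorPower.alternatingMapLinearEquiv_apply_ιMulti]
  exact (Matrix.det_fin_two _).trans rfl

lemma evalForm_smul_left (c : A) (D₁ D₂ : Derivation K A A) (x : ⋀[A]^2 Ω[A⁄K]) :
    evalForm (c • D₁) D₂ x = c * evalForm D₁ D₂ x := by
  have hc (y : Ω[A⁄K]) :
      (c • D₁).liftKaehlerDifferential y = c * D₁.liftKaehlerDifferential y := by
    induction y using kaehler_induction with
    | hD a => simp
    | hadd x y hx hy => simp only [map_add, hx, hy]; ring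
    | hsmul a x hx => simp only [map_smul, smul_eq_mul, hx]; ring
  induction x using form_induction with
  | h0 => simp
  | hι v => simp only [evalForm_ιMulti, hc]; ring
  | hadd x y hx hy => simp only [map_add, hx, hy]; ring
  | hsmul a x hx => simp only [map_smul, smul_eq_mul, hx]; ring

/-- If two derivations preserve a subring, then they evaluate the `2`-forms of this subring to its
elements. -/
lemma evalForm_formMap_mem_range (g : A →ₐ[K] B) (D₁ D₂ : Derivation K B B)
    (h₁ : ∀ a, D₁ (g a) ∈ g.range) (h₂ : ∀ a, D₂ (g a) ∈ g.range) (x : ⋀[A]^2 Ω[A⁄K]) :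
    evalForm D₁ D₂ (formMap g 2 x) ∈ g.range := by
  have key (D : Derivation K B B) (h : ∀ a, D (g a) ∈ g.range) (y : Ω[A⁄K]) :
      D.liftKaehlerDifferential (kaehlerMap g y) ∈ g.range := by
    induction y using kaehler_induction with
    | hD a => simpa [kaehlerMap_D] using h a
    | hadd x y hx hy => rw [map_add, map_add]; exact add_mem hx hy
    | hsmul a x hx => rw [kaehlerMap_smul, map_smul]; exact mul_mem ⟨a, rfl⟩ hx
  induction x using form_induction with
  | h0 => simp
  | hι v =>
    rw [formMap_ιMulti, evalForm_ιMulti]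
    exact sub_mem (mul_mem (key _ h₁ _) (key _ h₂ _)) (mul_mem (key _ h₂ _) (key _ h₁ _))
  | hadd x y hx hy => rw [map_add, map_add]; exact add_mem hx hy
  | hsmul a x hx => rw [formMap_smul, map_smul]; exact mul_mem ⟨a, rfl⟩ hx

end Forms

/-! ### Dimension -/

section Dimension

/-- The dimension is preserved by surjective closed maps without specializations in the fibres. -/
lemma topologicalKrullDim_eq_of_isClosedMap {X Y : Type*} [TopologicalSpace X] [TopologicalSpace Y]
    [QuasiSober X] [QuasiSober Y] [T0Space Y] {p : X → Y} (hc : Continuous p)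
    (hcl : IsClosedMap p) (hs : Function.Surjective p)
    (hinc : ∀ x y, x ⤳ y → p x = p y → y ⤳ x) :
    topologicalKrullDim X = topologicalKrullDim Y := by
  let φ : IrreducibleCloseds X → IrreducibleCloseds Y := IrreducibleCloseds.map p hc
  have hφ (Z : IrreducibleCloseds X) : (φ Z : Set Y) = p '' Z :=
    (hcl _ Z.isClosed).closure_eq
  let pt (x : X) : IrreducibleCloseds X :=
    ⟨closure {x}, isIrreducible_singleton.closure, isClosed_closure⟩
  have hpt (x : X) : (φ (pt x) : Set Y) = closure {p x} := by
    rw [hφ]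
    change p '' closure {x} = _
    rw [← hcl.closure_image_eq_of_continuous hc, Set.image_singleton]
  have hmono : StrictMono φ := by
    intro Z₁ Z₂ h
    refine lt_of_le_of_ne (IrreducibleCloseds.map_mono hc h.le) fun e => h.not_ge ?_
    obtain ⟨z₁, h₁⟩ := QuasiSober.sober Z₁.isIrreducible Z₁.isClosed
    obtain ⟨z₂, h₂⟩ := QuasiSober.sober Z₂.isIrreducible Z₂.isClosed
    obtain rfl : pt z₁ = Z₁ := IrreducibleCloseds.ext h₁
    obtain rfl : pt z₂ = Z₂ := IrreducibleCloseds.ext h₂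
    have e' : closure {p z₁} = closure {p z₂} := by rw [← hpt, ← hpt, e]
    have hsp : z₂ ⤳ z₁ := specializes_iff_mem_closure.mpr (h.le (subset_closure rfl))
    exact (hinc _ _ hsp (inseparable_iff_closure_eq.mpr e').eq.symm).closure_subset
  -- As `p` is closed, the generic point of `W` has a preimage in `Z`. Chains below `φ Z` thus lift,
  -- and `φ` preserves heights.
  have hlift (Z : IrreducibleCloseds X) (W : IrreducibleCloseds Y) (h : W < φ Z) :
      ∃ Z', Z' < Z ∧ φ Z' = W := by
    obtain ⟨w, hw⟩ := QuasiSober.sober W.isIrreducible W.isClosed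
    have hwZ : w ∈ (φ Z : Set Y) := h.le hw.mem
    rw [hφ] at hwZ
    obtain ⟨z, hz, rfl⟩ := hwZ
    have e : φ (pt z) = W := IrreducibleCloseds.ext ((hpt z).trans hw)
    refine ⟨pt z, lt_of_le_of_ne (closure_minimal (by simpa using hz) Z.isClosed) ?_, e⟩
    rintro rfl
    exact h.ne e.symm
  have hsurj : Function.Surjective φ := fun W => by
    obtain ⟨w, hw⟩ := QuasiSober.sober W.isIrreducible W.isClosed
    obtain ⟨z, rfl⟩ := hs w
    exact ⟨pt z, IrreducibleCloseds.ext ((hpt z).trans hw)⟩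
  rw [topologicalKrullDim, topologicalKrullDim, Order.krullDim_eq_iSup_height,
    Order.krullDim_eq_iSup_height, ← hsurj.iSup_comp]
  exact iSup_congr fun Z => congrArg _ (Order.height_eq_of_strictMono φ hmono hlift Z)

/-- Finite surjective morphisms of schemes preserve the dimension. -/
lemma topologicalKrullDim_eq_of_isFinite {X Y : Scheme.{u}} (p : X ⟶ Y) [IsFinite p]
    [Surjective p] : topologicalKrullDim X = topologicalKrullDim Y := by
  refine topologicalKrullDim_eq_of_isClosedMap p.continuous p.isClosedMap p.surjective
    fun x y hxy e => ?_
  have hd := p.isDiscrete_preimage_singleton (p y)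
  have := hd.to_subtype
  have hxy' : (⟨x, e⟩ : p ⁻¹' {p y}) ⤳ ⟨y, rfl⟩ :=
    Topology.IsInducing.subtypeVal.specializes_iff.mp hxy
  obtain rfl : x = y := congrArg Subtype.val hxy'.eq
  exact specializes_rfl

/-- An extension of rational function fields in one variable is finite. -/
lemma finite_ratFunc_algHom {k : Type u} [Field k] (φ : RatFunc k →ₐ[k] RatFunc k) :
    φ.toRingHom.Finite := by
  have hX : ¬ ∃ c, φ RatFunc.X = RatFunc.C c := by
    rintro ⟨c, hc⟩
    rw [← RatFunc.algebraMap_eq_C, ← φ.commutes] at hc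
    exact RatFunc.transcendental_X (φ.injective hc ▸ isAlgebraic_algebraMap c)
  -- The degree of `k(t)` over `k(y)` is the larger of the degrees of numerator and denominator of
  -- `y`, positive for nonconstant `y`.
  have hE : φ.fieldRange = IntermediateField.adjoin k {φ RatFunc.X} := by
    rw [← Set.image_singleton, ← IntermediateField.adjoin_map, RatFunc.adjoin_X,
      AlgHom.fieldRange_eq_map]
  have hfin : FiniteDimensional φ.fieldRange (RatFunc k) := by
    rw [hE]
    refine FiniteDimensional.of_finrank_pos ?_
    rw [RatFunc.finrank_eq_max_natDegree]
    by_contra h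
    exact hX ((RatFunc.eq_C_iff _).mpr (by omega))
  have h1 : (algebraMap φ.fieldRange (RatFunc k)).Finite := hfin
  exact h1.comp (RingHom.Finite.of_surjective φ.rangeRestrict.toRingHom φ.rangeRestrict_surjective)

/-- The base change of a geometrically integral curve along a finite field extension is a curve. -/
lemma isCurve_baseChange {K L : Type u} [Field K] [Field L] {C : Scheme.{u}} (c : C ⟶ Spec (.of K))
    (hc : IsCurve c) [GeometricallyIntegral c] (φ : K →+* L) (hφ : φ.Finite) :
    IsCurve (pullback.snd c (Spec.map (CommRingCat.ofHom φ))) := by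
  have := hc.separated
  have := hc.locallyOfFiniteType
  have := hc.quasiCompact
  have : IsFinite (Spec.map (CommRingCat.ofHom φ)) := (IsFinite.SpecMap_iff _).mpr hφ
  have : IsIntegral (pullback c (Spec.map (CommRingCat.ofHom φ))) :=
    GeometricallyIntegral.isIntegral_of_subsingleton
      (pullback.snd c (Spec.map (CommRingCat.ofHom φ)))
  exact
    { reduced := inferInstance
      separated := inferInstance
      locallyOfFiniteType := inferInstance
      quasiCompact := inferInstance
      dim_eq_one := (topologicalKrullDim_eq_of_isFinite
        (pullback.fst c (Spec.map (CommRingCat.ofHom φ)))).trans hc.dim_eq_one }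

end Dimension

/-! ### Evaluating functions at points with values in local rings -/

section Points

variable {k : Type u} [Field k] {X : Scheme.{u}} (f : X ⟶ Spec (.of k))

lemma top_le_preimage_top {X Y : Scheme.{u}} (g : X ⟶ Y) : ⊤ ≤ g ⁻¹ᵁ ⊤ := le_rfl

lemma appTop_eq_appLE {X Y : Scheme.{u}} (g : X ⟶ Y) :
    g.appTop = g.appLE ⊤ ⊤ (top_le_preimage_top g) :=
  g.appLE_eq_app.symm

/-- The value of functions on `U` at a point `x : Spec R ⟶ X` that factors through `U`. -/
def valueAt {R : Type u} [CommRing R] [Algebra k R] (x : Spec (.of R) ⟶ X)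
    (hx : x ≫ f = Spec.map (CommRingCat.ofHom (algebraMap k R))) (U : X.Opens)
    (hU : ⊤ ≤ x ⁻¹ᵁ U) : Sec f U →ₐ[k] R where
  __ := (x.appLE U ⊤ hU ≫ (Scheme.ΓSpecIso (.of R)).hom).hom
  commutes' r := by
    have e : (Scheme.ΓSpecIso (.of k)).inv ≫ f.appTop ≫
        X.presheaf.map (homOfLE le_top : U ⟶ ⊤).op ≫ x.appLE U ⊤ hU ≫
          (Scheme.ΓSpecIso (.of R)).hom = CommRingCat.ofHom (algebraMap k R) := by
      rw [Scheme.Hom.map_appLE_assoc, appTop_eq_appLE f,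
        Scheme.Hom.appLE_comp_appLE_assoc, ← appTop_eq_appLE, hx,
        Scheme.ΓSpecIso_naturality, Iso.inv_hom_id_assoc]
    exact ConcreteCategory.congr_hom e r

variable {f}

lemma valueAt_res {R : Type u} [CommRing R] [Algebra k R] (x : Spec (.of R) ⟶ X)
    (hx : x ≫ f = Spec.map (CommRingCat.ofHom (algebraMap k R))) {U V : X.Opens} (h : V ≤ U)
    (hV : ⊤ ≤ x ⁻¹ᵁ V) :
    (valueAt f x hx V hV).comp (res f h) = valueAt f x hx U (hV.trans (x.preimage_mono h)) := by
  ext a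
  have e : X.presheaf.map (homOfLE h).op ≫ x.appLE V ⊤ hV ≫ (Scheme.ΓSpecIso (.of R)).hom =
      x.appLE U ⊤ (hV.trans (x.preimage_mono h)) ≫ (Scheme.ΓSpecIso (.of R)).hom := by
    rw [Scheme.Hom.map_appLE_assoc]
  exact ConcreteCategory.congr_hom e a

lemma valueAt_comp {R S : Type u} [CommRing R] [Algebra k R] [CommRing S] [Algebra k S]
    (x : Spec (.of R) ⟶ X) (hx : x ≫ f = Spec.map (CommRingCat.ofHom (algebraMap k R)))
    (y : Spec (.of S) ⟶ X) (hy : y ≫ f = Spec.map (CommRingCat.ofHom (algebraMap k S)))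
    (g : R →ₐ[k] S) (hg : Spec.map (CommRingCat.ofHom g.toRingHom) ≫ x = y) {U : X.Opens}
    (hU : ⊤ ≤ x ⁻¹ᵁ U) (hU' : ⊤ ≤ y ⁻¹ᵁ U) :
    valueAt f y hy U hU' = g.comp (valueAt f x hx U hU) := by
  ext a
  subst hg
  have e : (Spec.map (CommRingCat.ofHom g.toRingHom) ≫ x).appLE U ⊤ hU' ≫
      (Scheme.ΓSpecIso (.of S)).hom =
        (x.appLE U ⊤ hU ≫ (Scheme.ΓSpecIso (.of R)).hom) ≫ CommRingCat.ofHom g.toRingHom := by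
    rw [Category.assoc, ← Scheme.ΓSpecIso_naturality,
      appTop_eq_appLE (Spec.map (CommRingCat.ofHom g.toRingHom)),
      Scheme.Hom.appLE_comp_appLE_assoc]
  exact ConcreteCategory.congr_hom e a

/-- A point with values in a local ring that maps the closed point to `U` factors through `U`. -/
lemma exists_affineOpen_le_preimage {R : Type u} [CommRing R] [IsLocalRing R]
    (x : Spec (.of R) ⟶ X) (W : X.Opens) (hW : ⊤ ≤ x ⁻¹ᵁ W) :
    ∃ U : X.affineOpens, U.1 ≤ W ∧ ⊤ ≤ x ⁻¹ᵁ U.1 := by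
  obtain ⟨_, ⟨U, hU, rfl⟩, hxU, hUW⟩ := X.isBasis_affineOpens.exists_subset_of_mem_open
    (show x (IsLocalRing.closedPoint R) ∈ (W : Set X) from hW trivial) W.isOpen
  exact ⟨⟨U, hU⟩, hUW, (Scheme.preimage_eq_top_of_closedPoint_mem x hxU).ge⟩

/-- A point with values in a ring is determined by the values of the functions on an affine open
subset. -/
lemma SpecMap_valueAt_fromSpec {R : Type u} [CommRing R] [Algebra k R] (x : Spec (.of R) ⟶ X)
    (hx : x ≫ f = Spec.map (CommRingCat.ofHom (algebraMap k R))) (U : X.affineOpens)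
    (hU : ⊤ ≤ x ⁻¹ᵁ U.1) :
    Spec.map (CommRingCat.ofHom (R := Γ(X, U.1)) (valueAt f x hx U.1 hU).toRingHom) ≫
      U.2.fromSpec = x := by
  have e := IsAffineOpen.SpecMap_appLE_fromSpec x U.2 (isAffineOpen_top _) hU
  rw [IsAffineOpen.fromSpec_top, Iso.eq_inv_comp, Scheme.isoSpec_Spec_hom] at e
  rw [← Spec.map_comp_assoc] at e
  exact e

end Points

/-! ### Differential forms on proper schemes at rational function fields -/

section RegularForms

variable {k : Type u} [Field k] {X : Scheme.{u}} {f : X ⟶ Spec (.of k)}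
  {ω : ∀ U : X.affineOpens, ⋀[Sec f U.1]^2 Ω[Sec f U.1⁄k]}

/-- The value of a global form at a point does not depend on the affine open subset. -/
lemma formMap_valueAt_eq {R : Type u} [CommRing R] [IsLocalRing R] [Algebra k R]
    (hω : ∀ (U V : X.affineOpens) (h : V.1 ≤ U.1), formMap (res f h) 2 (ω U) = ω V)
    (x : Spec (.of R) ⟶ X) (hx : x ≫ f = Spec.map (CommRingCat.ofHom (algebraMap k R)))
    (U V : X.affineOpens) (hU : ⊤ ≤ x ⁻¹ᵁ U.1) (hV : ⊤ ≤ x ⁻¹ᵁ V.1) :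
    formMap (valueAt f x hx U.1 hU) 2 (ω U) = formMap (valueAt f x hx V.1 hV) 2 (ω V) := by
  obtain ⟨W, hW, hxW⟩ := exists_affineOpen_le_preimage x (U.1 ⊓ V.1)
    fun y _ => ⟨hU trivial, hV trivial⟩
  have key (U : X.affineOpens) (hU : ⊤ ≤ x ⁻¹ᵁ U.1) (h : W.1 ≤ U.1) :
      formMap (valueAt f x hx U.1 hU) 2 (ω U) = formMap (valueAt f x hx W.1 hxW) 2 (ω W) := by
    rw [← valueAt_res x hx h hxW, formMap_comp, hω]
  rw [key U hU (hW.trans inf_le_left), key V hV (hW.trans inf_le_right)]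

/-- By the valuative criterion, a global form on a proper scheme is regular at every valuation ring
of a field over which the scheme has a point. -/
lemma evalForm_mem_valuationSubring [IsProper f] {L : Type u} [Field L] [Algebra k L]
    (hω : ∀ (U V : X.affineOpens) (h : V.1 ≤ U.1), formMap (res f h) 2 (ω U) = ω V)
    (x : Spec (.of L) ⟶ X) (hx : x ≫ f = Spec.map (CommRingCat.ofHom (algebraMap k L)))
    (U : X.affineOpens) (hU : ⊤ ≤ x ⁻¹ᵁ U.1) (O : ValuationSubring L)
    (hO : ∀ c : k, algebraMap k L c ∈ O) (D₁ D₂ : Derivation k L L)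
    (h₁ : ∀ a ∈ O, D₁ a ∈ O) (h₂ : ∀ a ∈ O, D₂ a ∈ O) :
    evalForm D₁ D₂ (formMap (valueAt f x hx U.1 hU) 2 (ω U)) ∈ O := by
  let : Algebra k O := ((algebraMap k L).codRestrict O.toSubring hO).toAlgebra
  let ι : O →ₐ[k] L := { algebraMap O L with commutes' := fun _ => rfl }
  have hval := (IsProper.eq_valuativeCriterion.le _ _ _ ‹IsProper f›).1.1.1
  -- The lift `l : Spec O ⟶ X` of this square lands in an affine `V` around the image of the closed
  -- point, so the form, computed on `V`, comes from `O`.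
  let S : ValuativeCommSq f :=
    { R := O
      K := L
      i₁ := x
      i₂ := Spec.map (CommRingCat.ofHom (algebraMap k O))
      commSq := ⟨by rw [hx, ← Spec.map_comp]; rfl⟩ }
  obtain ⟨⟨l, hl, hl'⟩⟩ := hval.existence S
  obtain ⟨V, -, hV⟩ := exists_affineOpen_le_preimage l ⊤ le_rfl
  have hV' : ⊤ ≤ x ⁻¹ᵁ V.1 := by
    rw [← show Spec.map (CommRingCat.ofHom ι.toRingHom) ≫ l = x from hl]
    intro y _
    exact hV trivial
  rw [formMap_valueAt_eq hω x hx U V hU hV', valueAt_comp l hl' x hx ι hl hV hV', formMap_comp]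
  have hmem : ∀ b : L, b ∈ ι.range ↔ b ∈ O :=
    fun b => ⟨by rintro ⟨a, rfl⟩; exact a.2, fun h => ⟨⟨b, h⟩, rfl⟩⟩
  rw [← hmem]
  exact evalForm_formMap_mem_range ι D₁ D₂ (fun a => (hmem _).mpr (h₁ _ a.2))
    (fun a => (hmem _).mpr (h₂ _ a.2)) _

/-- Turns a degree bound on a derivation of polynomials into regularity at infinity. -/
lemma inftyValuation_algebraMap_le {F : Type*} [Field F] [DecidableEq (RatFunc F)]
    {p q : Polynomial F} (h : q.degree ≤ p.degree) :
    RatFunc.inftyValuation F (algebraMap _ _ q) ≤ RatFunc.inftyValuation F (algebraMap _ _ p) := by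
  rcases eq_or_ne q 0 with rfl | hq
  · simp
  have hp : p ≠ 0 := by rintro rfl; simp_all
  rw [RatFunc.inftyValuation_apply, RatFunc.inftyValuation_apply,
    RatFunc.inftyValuation.polynomial _ hp, RatFunc.inftyValuation.polynomial _ hq,
    WithZero.exp_le_exp]
  exact_mod_cast Polynomial.natDegree_le_natDegree h

/-- A rational function field `F(t)` has no nonzero regular `2`-forms: a global form on a proper
scheme vanishes at `∂/∂t` and a derivation of `F`. -/
lemma evalForm_ratFunc_eq_zero [IsProper f] {F : Type u} [Field F] [Algebra k F]
    (hω : ∀ (U V : X.affineOpens) (h : V.1 ≤ U.1), formMap (res f h) 2 (ω U) = ω V)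
    (x : Spec (.of (RatFunc F)) ⟶ X)
    (hx : x ≫ f = Spec.map (CommRingCat.ofHom (algebraMap k (RatFunc F))))
    (U : X.affineOpens) (hU : ⊤ ≤ x ⁻¹ᵁ U.1) (D₁ D₂ : Derivation k (RatFunc F) (RatFunc F))
    (h₁ : ∀ p : Polynomial F, D₁ (algebraMap _ _ p) = algebraMap _ _ (Polynomial.derivative p))
    (d : Derivation k (Polynomial F) (Polynomial F)) (hd : ∀ p, (d p).degree ≤ p.degree)
    (h₂ : ∀ p : Polynomial F, D₂ (algebraMap _ _ p) = algebraMap _ _ (d p)) :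
    evalForm D₁ D₂ (formMap (valueAt f x hx U.1 hU) 2 (ω U)) = 0 := by
  classical
  have hk (c : k) : algebraMap k (RatFunc F) c =
      algebraMap (Polynomial F) (RatFunc F) (Polynomial.C (algebraMap k F c)) := by
    rw [IsScalarTower.algebraMap_apply k (Polynomial F) (RatFunc F)]; rfl
  refine ratFunc_eq_zero_of_valuation (fun v => ?_) ?_
  · refine evalForm_mem_valuationSubring hω x hx U hU (v.valuation (RatFunc F)).valuationSubring
      (fun c => ?_) D₁ D₂
      (fun a ha => valuation_derivation_le_one v D₁ (fun p => ⟨_, h₁ p⟩) ha)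
      (fun a ha => valuation_derivation_le_one v D₂ (fun p => ⟨_, h₂ p⟩) ha)
    rw [hk]
    exact v.valuation_le_one _
  -- At infinity `∂/∂t` is replaced by `t ∂/∂t`, which does not raise degrees; this produces the
  -- factor `X`.
  · rw [← evalForm_smul_left]
    refine evalForm_mem_valuationSubring hω x hx U hU (RatFunc.inftyValuation F).valuationSubring
      (fun c => ?_) (RatFunc.X • D₁) D₂ (fun a ha => ?_) (fun a ha => ?_)
    · rw [hk, Valuation.mem_valuationSubring_iff, ← map_one (RatFunc.inftyValuation F),
        ← map_one (algebraMap (Polynomial F) (RatFunc F))]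
      exact inftyValuation_algebraMap_le (by simpa using Polynomial.degree_C_le)
    · refine (valuation_derivation_le (A := Polynomial F) (RatFunc.inftyValuation F) _
        (fun p => ?_) a).trans ha
      rw [Derivation.smul_apply, h₁, smul_eq_mul, ← RatFunc.algebraMap_X, ← map_mul]
      refine inftyValuation_algebraMap_le ?_
      rcases eq_or_ne p 0 with rfl | h
      · simp
      · rw [Polynomial.degree_mul, Polynomial.degree_X, add_comm]
        exact Nat.WithBot.add_one_le_of_lt (Polynomial.degree_derivative_lt h)
    · refine (valuation_derivation_le (A := Polynomial F) (RatFunc.inftyValuation F) _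
        (fun p => ?_) a).trans ha
      rw [h₂]
      exact inftyValuation_algebraMap_le (hd p)

end RegularForms

/-! ### Points of the base change of a fibration -/

section Dominance

/-- If the canonical bundle of a proper scheme is trivial and every derivation of `F(t)` that
annihilates the functions at an `F(t)`-valued point is zero, then `F` has no nonzero derivation. -/
lemma derivation_eq_zero_of_dominant {k : Type u} [Field k] {X : Scheme.{u}}
    {f : X ⟶ Spec (.of k)} [IsProper f] (hf : TrivialCanonicalBundle f) {F : Type u} [Field F]
    [Algebra k F] (x : Spec (.of (RatFunc F)) ⟶ X)
    (hx : x ≫ f = Spec.map (CommRingCat.ofHom (algebraMap k (RatFunc F))))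
    (U : X.affineOpens) (hU : ⊤ ≤ x ⁻¹ᵁ U.1)
    (H : ∀ D : Derivation k (RatFunc F) (RatFunc F),
      (∀ a, D (valueAt f x hx U.1 hU a) = 0) → D = 0) (d : Derivation k F F) : d = 0 := by
  obtain ⟨ω, hω, hbij⟩ := hf
  obtain ⟨δ, hδ⟩ := exists_derivation_coeff d
  obtain ⟨D₁, h₁⟩ := exists_derivation_localization (B := RatFunc F)
    (nonZeroDivisors (Polynomial F)) ((Polynomial.derivative' (R := F)).restrictScalars k)
  obtain ⟨D₂, h₂⟩ := exists_derivation_localization (B := RatFunc F)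
    (nonZeroDivisors (Polynomial F)) δ
  have hdeg (p : Polynomial F) : (δ p).degree ≤ p.degree := by
    refine Polynomial.degree_le_iff_coeff_zero _ _ |>.mpr fun n hn => ?_
    rw [hδ, Polynomial.coeff_eq_zero_of_degree_lt hn, map_zero]
  set v := valueAt f x hx U.1 hU with hv
  have hdet (a b : Sec f U.1) : D₁ (v a) * D₂ (v b) = D₂ (v a) * D₁ (v b) := by
    -- `da ∧ db` is a multiple of `ω`, hence also vanishes on `D₁, D₂`.
    obtain ⟨c, hc⟩ := (hbij U).2 (exteriorPower.ιMulti (Sec f U.1) 2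
      ![KaehlerDifferential.D k _ a, KaehlerDifferential.D k _ b])
    have e := evalForm_ratFunc_eq_zero hω x hx U hU D₁ D₂ h₁ δ hdeg h₂
    have e' := congrArg (fun y => evalForm D₁ D₂ (formMap v 2 y)) hc
    simp only [formMap_smul, map_smul, formMap_ιMulti, evalForm_ιMulti] at e'
    rw [e] at e'
    simpa [kaehlerMap_D, sub_eq_zero] using e'.symm
  have hX₁ : D₁ RatFunc.X = 1 := by
    rw [← RatFunc.algebraMap_X, h₁]
    simp
  have hX₂ : D₂ RatFunc.X = 0 := by
    rw [← RatFunc.algebraMap_X, h₂, (show δ Polynomial.X = 0 from ?_), map_zero]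
    ext n
    rw [hδ, Polynomial.coeff_X]
    split_ifs <;> simp
  obtain ⟨a, ha⟩ : ∃ a, D₁ (v a) ≠ 0 := by
    by_contra! h
    simp [H D₁ h] at hX₁
  -- By `hdet`, `D₁` and `D₂` are proportional on the functions at `x`, hence everywhere; evaluation
  -- at `X` shows that the factor is 0.
  have hD := H (D₂ - (D₂ (v a) / D₁ (v a)) • D₁) fun b => by
    have := hdet a b
    simp only [Derivation.sub_apply, Derivation.smul_apply, smul_eq_mul]
    field_simp
    linear_combination this
  have hc : D₂ (v a) / D₁ (v a) = 0 := by
    have := congrArg (fun D : Derivation k (RatFunc F) (RatFunc F) => D RatFunc.X) hD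
    simpa [hX₁, hX₂] using this
  rw [hc, zero_smul, sub_zero] at hD
  ext c
  have e := h₂ (Polynomial.C c)
  rw [hD] at e
  have e₀ : δ (Polynomial.C c) = 0 :=
    (map_eq_zero_iff _ (RatFunc.algebraMap_injective F)).mp e.symm
  simpa [e₀] using (hδ (Polynomial.C c) 0).symm

/-- The affine coordinate of the projective line. -/
lemma exists_chartToRatFunc_eq_X (k : Type u) [Field k] :
    ∃ e, P1.chartToRatFunc k e = RatFunc.X := by
  refine ⟨HomogeneousLocalization.Away.mk (MvPolynomial.homogeneousSubmodule (Fin 2) k)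
    ((MvPolynomial.mem_homogeneousSubmodule 1 _).mpr (MvPolynomial.isHomogeneous_X k 0)) 1
    (MvPolynomial.X 1) ?_, ?_⟩
  · simpa using MvPolynomial.isHomogeneous_X k (1 : Fin 2)
  · rw [P1.chartToRatFunc, RingHom.comp_apply, HomogeneousLocalization.algebraMap_apply,
      HomogeneousLocalization.Away.val_mk, Localization.mk_eq_mk', IsLocalization.Away.lift,
      IsLocalization.lift_mk'_spec]
    simp

/-- Field extensions are faithfully flat. This lets equalities of morphisms descend from `L` to the
constants of a derivation. -/
lemma epi_SpecMap {K L : Type u} [Field K] [Field L] (j : K →+* L) :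
    Epi (Spec.map (CommRingCat.ofHom j)) :=
  Flat.epi_of_flat_of_surjective _

/-- Let `q` be an `L`-valued point of the base change `X_{k(t)}`, and let `D` be a derivation of `L`
that annihilates the values of functions at the image of `q` in `X`. Then `q` is defined over the
constants of `D`. -/
lemma exists_point_constants {k : Type u} [Field k] [CharZero k] {X : Scheme.{u}}
    {f : X ⟶ Spec (.of k)} {π : X ⟶ P1 k} (φ : RatFunc k →ₐ[k] RatFunc k) {L : Type u} [Field L]
    [Algebra k L] (ψ : RatFunc k →ₐ[k] L)
    (q : Spec (.of L) ⟶
      pullback (genericFibreToSpec π) (Spec.map (CommRingCat.ofHom φ.toRingHom)))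
    (hq : q ≫ genericFibreBaseChangeToSpec π φ = Spec.map (CommRingCat.ofHom ψ.toRingHom))
    (x : Spec (.of L) ⟶ X) (hqx : q ≫ pullback.fst _ _ ≫ pullback.fst _ _ = x)
    (hx : x ≫ f = Spec.map (CommRingCat.ofHom (algebraMap k L)))
    (U : X.affineOpens) (hU : ⊤ ≤ x ⁻¹ᵁ U.1) (D : Derivation k L L)
    (hD : ∀ a, D (valueAt f x hx U.1 hU a) = 0) :
    (∀ z, D (ψ z) = 0) ∧ ∃ q₀ : Spec (.of (constants D)) ⟶
        pullback (genericFibreToSpec π) (Spec.map (CommRingCat.ofHom φ.toRingHom)),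
      Spec.map (CommRingCat.ofHom (algebraMap (constants D) L)) ≫ q₀ = q := by
  let j := Spec.map (CommRingCat.ofHom (algebraMap (constants D) L))
  have hepi : Epi j := epi_SpecMap _
  let v := valueAt f x hx U.1 hU
  let v₀ : Sec f U.1 →+* constants D := v.toRingHom.codRestrict (constants D).toSubfield hD
  let x₀ : Spec (.of (constants D)) ⟶ X :=
    Spec.map (CommRingCat.ofHom (R := Γ(X, U.1)) v₀) ≫ U.2.fromSpec
  have hx₀ : j ≫ x₀ = x := by
    rw [← SpecMap_valueAt_fromSpec x hx U hU, ← Spec.map_comp_assoc]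
    rfl
  have hπ : j ≫ x₀ ≫ π = Spec.map (CommRingCat.ofHom ψ.toRingHom) ≫
      Spec.map (CommRingCat.ofHom φ.toRingHom) ≫ P1.genericPoint k := by
    rw [reassoc_of% hx₀, ← hqx, ← hq]
    simp only [Category.assoc]
    rw [pullback.condition, ← pullback.condition_assoc]
  have hu : D (ψ (φ RatFunc.X)) = 0 := by
    obtain ⟨e, he⟩ := exists_chartToRatFunc_eq_X k
    rw [P1.genericPoint] at hπ
    set ι := Proj.awayι (MvPolynomial.homogeneousSubmodule (Fin 2) k) (MvPolynomial.X 0)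
      ((MvPolynomial.mem_homogeneousSubmodule 1 _).mpr (MvPolynomial.isHomogeneous_X k 0)) one_pos
    -- Membership in the chart can be tested after the surjection `j`; the coordinate `u` is then
    -- the value of a function over the constants.
    have hrange : Set.range (x₀ ≫ π) ⊆ Set.range ι := by
      rintro _ ⟨s, rfl⟩
      obtain ⟨t, rfl⟩ := j.surjective s
      rw [← Scheme.Hom.comp_apply, hπ]
      exact ⟨(Spec.map (CommRingCat.ofHom ψ.toRingHom) ≫ Spec.map (CommRingCat.ofHom φ.toRingHom) ≫
        Spec.map (CommRingCat.ofHom (P1.chartToRatFunc k))) t, rfl⟩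
    obtain ⟨ρ, hρ⟩ := Spec.map_surjective (IsOpenImmersion.lift ι (x₀ ≫ π) hrange)
    have h : j ≫ Spec.map ρ = Spec.map (CommRingCat.ofHom ψ.toRingHom) ≫
        Spec.map (CommRingCat.ofHom φ.toRingHom) ≫
          Spec.map (CommRingCat.ofHom (P1.chartToRatFunc k)) := by
      rw [← cancel_mono ι, hρ, Category.assoc, IsOpenImmersion.lift_fac, hπ]
      simp only [Category.assoc]
    rw [← Spec.map_comp, ← Spec.map_comp, ← Spec.map_comp, Spec.map_inj] at h
    have h' : (algebraMap (constants D) L).comp ρ.hom =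
        (ψ.toRingHom.comp φ.toRingHom).comp (P1.chartToRatFunc k) :=
      congrArg CommRingCat.Hom.hom h
    have h'' : algebraMap (constants D) L (ρ.hom e) = ψ (φ (P1.chartToRatFunc k e)) :=
      RingHom.congr_fun h' e
    rw [← he, ← h'']
    exact (ρ.hom e).2
  have hψ (z : RatFunc k) : D (ψ z) = 0 := by
    let : Algebra (RatFunc k) L := ψ.toRingHom.toAlgebra
    have : IsScalarTower k (RatFunc k) L :=
      IsScalarTower.of_algebraMap_eq fun r => (ψ.commutes r).symm
    refine ratFunc_derivation_eq_zero (D.compAlgebraMap (RatFunc k)) (y := φ RatFunc.X) ?_ hu z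
    exact fun h => RatFunc.transcendental_X ((isAlgebraic_algHom_iff φ φ.injective).mp h)
  refine ⟨hψ, ?_⟩
  let ψ₀ : RatFunc k →+* constants D := ψ.toRingHom.codRestrict (constants D).toSubfield hψ
  have hψ₀ : j ≫ Spec.map (CommRingCat.ofHom ψ₀) = Spec.map (CommRingCat.ofHom ψ.toRingHom) := by
    rw [← Spec.map_comp]
    rfl
  have hcond : x₀ ≫ π = (Spec.map (CommRingCat.ofHom ψ₀) ≫
      Spec.map (CommRingCat.ofHom φ.toRingHom)) ≫ P1.genericPoint k := by
    rw [← cancel_epi j, hπ, ← hψ₀]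
    simp only [Category.assoc]
  refine ⟨pullback.lift (pullback.lift x₀ _ hcond) (Spec.map (CommRingCat.ofHom ψ₀))
    (pullback.lift_snd _ _ _), ?_⟩
  refine pullback.hom_ext (pullback.hom_ext ?_ ?_) ?_
  · rw [Category.assoc, Category.assoc, pullback.lift_fst_assoc, pullback.lift_fst, Category.assoc,
      hqx]
    exact hx₀
  · rw [Category.assoc, Category.assoc, pullback.lift_fst_assoc, pullback.lift_snd, Category.assoc,
      pullback.condition, reassoc_of% hq, ← reassoc_of% hψ₀]
  · rw [Category.assoc, pullback.lift_snd, hq]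
    exact hψ₀

end Dominance

/-! ### The function field of a curve -/

section FunctionField

/-- If a point of `C` over a subfield becomes a point at `η` over a larger field, then the residue
field of `η` embeds into the subfield. -/
lemma exists_eq_of_residueField {K L : Type u} [Field K] [Field L] (j : K →+* L) {C : Scheme.{u}}
    (y : Spec (.of K) ⟶ C) (η : C) (i : C.residueField η ⟶ .of L)
    (h : Spec.map (CommRingCat.ofHom j) ≫ y = Spec.map i ≫ C.fromSpecResidueField η)
    (c : C.residueField η) : ∃ a, j a = i.hom c := by
  obtain ⟨⟨z, g⟩, hz⟩ := (Scheme.SpecToEquivOfField K C).symm.surjective y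
  rw [Scheme.SpecToEquivOfField_symm_apply] at hz
  subst hz
  obtain rfl : z = η := by
    -- Both composites send the unique point of `Spec L` to the same place, so `y` is supported at
    -- `η`.
    have := congrArg (fun m : Spec (.of L) ⟶ C => m (IsLocalRing.closedPoint L)) h
    change C.fromSpecResidueField z _ = C.fromSpecResidueField η _ at this
    rwa [Scheme.fromSpecResidueField_apply, Scheme.fromSpecResidueField_apply] at this
  rw [← Category.assoc, cancel_mono, ← Spec.map_comp, Spec.map_inj] at h
  exact ⟨g.hom c, ConcreteCategory.congr_hom h c⟩

/-- The residue field at the generic point of an integral curve is transcendental over the ground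
field. -/
lemma not_isAlgebraic_of_topologicalKrullDim {k : Type u} [Field k] {C : Scheme.{u}} [IsIntegral C]
    (c : C ⟶ Spec (.of k)) (hdim : topologicalKrullDim C = 1) {F : Type u} [Field F] [Algebra k F]
    (x : Spec (.of F) ⟶ C) (hx : x ≫ c = Spec.map (CommRingCat.ofHom (algebraMap k F)))
    (hgen : ∀ s, x s = genericPoint C) : ¬ Algebra.IsAlgebraic k F := by
  intro halg
  have hmem (V : C.Opens) (hV : (V : Set C).Nonempty) : ⊤ ≤ x ⁻¹ᵁ V := fun s _ => by
    change x s ∈ V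
    rw [hgen]
    exact ((genericPoint_spec C).mem_open_set_iff V.isOpen).mpr (by simpa using hV)
  -- If `F` were algebraic, the functions on an affine open, embedded in `F`, would be integral over
  -- `k`, hence form a field: `C` would be a single point.
  have hpt (y : C) : y = genericPoint C := by
    obtain ⟨_, ⟨U, hU, rfl⟩, hyU, -⟩ := C.isBasis_affineOpens.exists_subset_of_mem_open
      (Set.mem_univ y) isOpen_univ
    have hxU := hmem U ⟨y, hyU⟩
    have : Nonempty U := ⟨⟨y, hyU⟩⟩
    have : IsDomain (Sec c U) := inferInstanceAs (IsDomain Γ(C, U))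
    have hinj : Function.Injective (valueAt c x hx U hxU) := by
      rw [injective_iff_map_eq_zero]
      intro a ha
      -- A nonzero `a` is a unit on its basic open, which contains the generic point, so its value
      -- is a unit.
      by_contra ha0
      have hle : C.basicOpen (U := U) a ≤ U := C.basicOpen_le a
      have hxa := hmem (C.basicOpen (U := U) a) 
        ((Opens.ne_bot_iff_nonempty _).mp fun h => ha0 ((basicOpen_eq_bot_iff (U := U) a).mp h))
      have hunit : IsUnit (res c hle a) := RingedSpace.isUnit_res_basicOpen _ _
      have := (hunit.map (valueAt c x hx _ hxa)).ne_zero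
      rw [← AlgHom.comp_apply, valueAt_res] at this
      exact this ha
    have hint : Algebra.IsIntegral k (Sec c U) := ⟨fun a =>
      (isIntegral_algHom_iff (valueAt c x hx U hxU) hinj).mp (halg.isAlgebraic _).isIntegral⟩
    have hfield : IsField Γ(C, U) :=
      isField_of_isIntegral_of_isField' (R := k) (S := Sec c U) (Field.toIsField k)
    have hbot (p : Spec Γ(C, U)) : p.asIdeal = ⊥ := by
      refine (Submodule.eq_bot_iff _).mpr fun a ha => ?_
      by_contra ha0
      obtain ⟨b, hb⟩ := hfield.mul_inv_cancel ha0
      exact p.isPrime.ne_top ((Ideal.eq_top_iff_one _).mpr (hb ▸ Ideal.mul_mem_right b _ ha))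
    have hrange (z : C) (hz : z ∈ U) : ∃ p, hU.fromSpec p = z := by
      have : z ∈ Set.range hU.fromSpec := by rwa [hU.range_fromSpec]
      exact this
    obtain ⟨p, hp⟩ := hrange y hyU
    obtain ⟨p', hp'⟩ := hrange (genericPoint C)
      (((genericPoint_spec C).mem_open_set_iff U.isOpen).mpr (by simpa using ⟨y, hyU⟩))
    rw [← hp, ← hp', show p = p' from PrimeSpectrum.ext ((hbot p).trans (hbot p').symm)]
  have : Subsingleton C := ⟨fun y z => (hpt y).trans (hpt z).symm⟩
  have h := topologicalKrullDim_zero_of_discreteTopology C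
  rw [hdim] at h
  exact absurd h (by decide)

end FunctionField

/-! ### Nonconstancy of the base change -/

/-- A derivation of `F(t)` that annihilates `F` and `t` vanishes. -/
lemma ratFunc_derivation_ext {k F : Type*} [Field k] [Field F] [Algebra k F]
    (D : Derivation k (RatFunc F) (RatFunc F)) (hF : ∀ a, D (algebraMap F (RatFunc F) a) = 0)
    (hX : D RatFunc.X = 0) : D = 0 := by
  have hp (p : Polynomial F) : algebraMap _ (RatFunc F) p ∈ constants D := by
    induction p using Polynomial.induction_on' with
    | add p q hp hq => rw [map_add]; exact add_mem hp hq
    | monomial n a =>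
      rw [← Polynomial.C_mul_X_pow_eq_monomial, map_mul, map_pow, RatFunc.algebraMap_X]
      exact mul_mem (hF a) (pow_mem (mem_constants.mpr hX) n)
  ext r
  rw [← RatFunc.num_div_denom r]
  exact div_mem (hp _) (hp _)

lemma exists_ratFunc_algHom (k F : Type*) [Field k] [Field F] [Algebra k F] :
    ∃ ψ : RatFunc k →ₐ[k] RatFunc F, ψ RatFunc.X = RatFunc.X := by
  have h := nonZeroDivisors_le_comap_nonZeroDivisors_of_injective
    (Polynomial.mapAlgHom (Algebra.ofId k F))
    (Polynomial.map_injective _ (algebraMap k F).injective)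
  refine ⟨RatFunc.mapAlgHom (Polynomial.mapAlgHom (Algebra.ofId k F)) h, ?_⟩
  have e := RatFunc.map_apply_div (Polynomial.mapAlgHom (Algebra.ofId k F)) h Polynomial.X 1
  simpa [RatFunc.coe_mapAlgHom_eq_coe_map] using e

lemma genericPoint_toSpec (k : Type u) [Field k] :
    P1.genericPoint k ≫ P1.toSpec k =
      Spec.map (CommRingCat.ofHom (algebraMap k (RatFunc k))) := by
  rw [P1.genericPoint, P1.toSpec, Category.assoc, Proj.awayι_toSpecZero_assoc, ← Spec.map_comp,
    ← Spec.map_comp]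
  congr 1
  ext r
  simp only [CommRingCat.hom_comp, CommRingCat.hom_ofHom, RingHom.comp_apply, P1.chartToRatFunc]
  have e (a : MvPolynomial.homogeneousSubmodule (Fin 2) k 0) :
      algebraMap (HomogeneousLocalization.Away (MvPolynomial.homogeneousSubmodule (Fin 2) k)
      (MvPolynomial.X 0)) (Localization.Away (MvPolynomial.X 0 : MvPolynomial (Fin 2) k))
      (HomogeneousLocalization.fromZeroRingHom (MvPolynomial.homogeneousSubmodule (Fin 2) k)
        (Submonoid.powers (MvPolynomial.X 0)) a) =
      algebraMap (MvPolynomial (Fin 2) k)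
        (Localization.Away (MvPolynomial.X 0 : MvPolynomial (Fin 2) k)) a.1 := by
    rw [HomogeneousLocalization.algebraMap_apply]
    exact Localization.mk_one_eq_algebraMap a.1
  rw [e, IsLocalization.Away.lift_eq]
  exact MvPolynomial.aeval_C _ r

/-- Holds because the generic point of `ℙ¹`, `φ` and `ψ` are all compatible with `k`. -/
lemma comp_eq_SpecMap_algebraMap {k : Type u} [Field k] {X : Scheme.{u}}
    {f : X ⟶ Spec (.of k)} {π : X ⟶ P1 k} (hπ : π ≫ P1.toSpec k = f)
    (φ : RatFunc k →ₐ[k] RatFunc k) {L : Type u} [Field L] [Algebra k L] (ψ : RatFunc k →ₐ[k] L)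
    (q : Spec (.of L) ⟶
      pullback (genericFibreToSpec π) (Spec.map (CommRingCat.ofHom φ.toRingHom)))
    (hq : q ≫ genericFibreBaseChangeToSpec π φ = Spec.map (CommRingCat.ofHom ψ.toRingHom)) :
    (q ≫ pullback.fst _ _ ≫ pullback.fst _ _) ≫ f =
      Spec.map (CommRingCat.ofHom (algebraMap k L)) := by
  simp only [Category.assoc]
  rw [← hπ, pullback.condition_assoc, genericPoint_toSpec, pullback.condition_assoc,
    reassoc_of% hq, ← Spec.map_comp, ← Spec.map_comp]
  congr 1
  ext r
  exact (congrArg ψ (φ.commutes r)).trans (ψ.commutes r)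

/-- The base change of the generic fibre of a fibration of a proper surface with trivial canonical
bundle to a rational function field is not constant. -/
lemma not_isConstant {k : Type u} [Field k] [CharZero k] {X : Scheme.{u}} (f : X ⟶ Spec (.of k))
    [IsProper f] (hf : TrivialCanonicalBundle f) (π : X ⟶ P1 k) (hπ : π ≫ P1.toSpec k = f)
    [GeometricallyIntegral (genericFibreToSpec π)] (φ : RatFunc k →ₐ[k] RatFunc k) :
    ¬ IsConstant k (genericFibreBaseChangeToSpec π φ) := by
  rintro ⟨C, c, hc, ⟨iso⟩⟩
  let Y := pullback (genericFibreToSpec π) (Spec.map (CommRingCat.ofHom φ.toRingHom))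
  let Z := pullback c (Spec.map (CommRingCat.ofHom (algebraMap k (RatFunc k))))
  let e : Y ⟶ Z := iso.hom.left
  let e' : Z ⟶ Y := iso.inv.left
  have hee' : e' ≫ e = 𝟙 Z := congrArg CommaMorphism.left iso.inv_hom_id
  have he' : e' ≫ genericFibreBaseChangeToSpec π φ = pullback.snd c _ := Over.w iso.inv
  have hYint : IsIntegral Y :=
    GeometricallyIntegral.isIntegral_of_subsingleton (genericFibreBaseChangeToSpec π φ)
  -- `C` is irreducible as the image of the integral scheme `Y` under `Y ≅ Z ⟶ C`.
  have hCint : IsIntegral C := by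
    have hesurj : Function.Surjective e :=
      fun w => ⟨e' w, by rw [← Scheme.Hom.comp_apply, hee']; rfl⟩
    let p := pullback.fst c (Spec.map (CommRingCat.ofHom (algebraMap k (RatFunc k))))
    have : IrreducibleSpace C :=
      Function.Surjective.irreducibleSpace (p.continuous.comp e.continuous)
        (p.surjective.comp hesurj)
    have := hc.reduced
    exact isIntegral_of_irreducibleSpace_of_isReduced C
  let η := genericPoint C
  let F : Type u := C.residueField η
  let y : Spec (.of F) ⟶ C := C.fromSpecResidueField η
  obtain ⟨α, hα⟩ := Spec.map_surjective (y ≫ c)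
  let : Algebra k F := α.hom.toAlgebra
  have hy : y ≫ c = Spec.map (CommRingCat.ofHom (algebraMap k F)) := hα.symm
  have htr := not_isAlgebraic_of_topologicalKrullDim c hc.dim_eq_one y hy
    (Scheme.fromSpecResidueField_apply η)
  obtain ⟨d, hd⟩ := exists_derivation_ne_zero htr
  let i : F →+* RatFunc F := algebraMap F (RatFunc F)
  obtain ⟨ψ, hψX⟩ := exists_ratFunc_algHom k F
  -- The point of `C ⊗ k(t)` given by the generic point of `C` and `t ↦ t`.
  let z : Spec (.of (RatFunc F)) ⟶ Z := pullback.lift (Spec.map (CommRingCat.ofHom i) ≫ y)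
    (Spec.map (CommRingCat.ofHom ψ.toRingHom)) (by
      rw [Category.assoc, hy, ← Spec.map_comp, ← Spec.map_comp]
      congr 1
      ext r
      exact (IsScalarTower.algebraMap_apply k F (RatFunc F) r).symm.trans (ψ.commutes r).symm)
  let q := z ≫ e'
  have hq : q ≫ genericFibreBaseChangeToSpec π φ = Spec.map (CommRingCat.ofHom ψ.toRingHom) := by
    rw [Category.assoc, he', pullback.lift_snd]
  let x : Spec (.of (RatFunc F)) ⟶ X := q ≫ pullback.fst _ _ ≫ pullback.fst _ _
  have hx : x ≫ f = Spec.map (CommRingCat.ofHom (algebraMap k (RatFunc F))) :=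
    comp_eq_SpecMap_algebraMap hπ φ ψ q hq
  obtain ⟨U, -, hU⟩ := exists_affineOpen_le_preimage x ⊤ le_rfl
  refine hd (derivation_eq_zero_of_dominant hf x hx U hU (fun D hD => ?_) d)
  obtain ⟨hψ, q₀, hq₀⟩ := exists_point_constants φ ψ q hq x rfl hx U hU D hD
  -- Carried to `C`, `q₀` is a point over the constants that becomes `η` over `F(t)`, so `F` lies in
  -- the constants.
  have hF (a : F) : D (i a) = 0 := by
    obtain ⟨b, hb⟩ := exists_eq_of_residueField (algebraMap (constants D) (RatFunc F))
      (q₀ ≫ e ≫ pullback.fst _ _) η (CommRingCat.ofHom i) (by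
        rw [reassoc_of% hq₀, Category.assoc, reassoc_of% hee', pullback.lift_fst]
        rfl) a
    rw [← show algebraMap (constants D) (RatFunc F) b = i a from hb]
    exact b.2
  exact ratFunc_derivation_ext D hF (hψX ▸ hψ RatFunc.X)

end K3Fib

end

theorem mainTheorem6 {k : Type u} [Field k] [IsAlgClosed k] [CharZero k]
    {X : Scheme.{u}} (f : X ⟶ Spec (.of k)) (hX : K3Fib.IsK3Surface f)
    (π : X ⟶ K3Fib.P1 k) (hπ : K3Fib.IsGenusOneFibration f π)
    (φ : RatFunc k →ₐ[k] RatFunc k) :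
    K3Fib.IsCurve (K3Fib.genericFibreBaseChangeToSpec π φ) ∧
      ¬ K3Fib.IsConstant k (K3Fib.genericFibreBaseChangeToSpec π φ) := by
  have := hX.proper
  have := hπ.generic.geometricallyIntegral
  exact ⟨K3Fib.isCurve_baseChange _ hπ.generic.isCurve φ.toRingHom (K3Fib.finite_ratFunc_algHom φ),
    K3Fib.not_isConstant f hX.trivialCanonicalBundle π hπ.comp_toSpec φ⟩
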